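/- Proposition. Let $\Omega\subset\mathbb{R}^3$ be open and let $w\in C^\infty(\Omega;\mathbb{R}^3)$ solve the magnetofluidostatic system $$w\times(\nabla\times w)=\nabla\chi,\qquad \nabla\cdot w=0\qquad\text{in }\Omega$$ with some $\chi\in C^1(\Omega)$. Let $\xi\in C^\infty(\Omega;\mathbb{R}^3)$ satisfy $\xi\neq 0$ and $\nabla\cdot\xi=0$ in $\Omega$, and let $\xi$ be a symmetry of $w$, that is, $(\xi\cdot\nabla)w-(w\cdot\nabla)\xi=0$ in $\Omega$. Then for every $x\in\Omega$ there are an open neighborhood $U\subset\Omega$ of $x$, smooth curvilinear coordinates $(x^1,x^2,x^3)$ on $U$ (with tangent vectors $\partial_i$) such that $\partial_3=\xi$, and smooth functions $\Theta=\Theta(x^1,x^2)$ and $w^3=w^3(x^1,x^2)$ of $x^1$ and $x^2$ only, such that $$w^3=w\cdot\nabla x^3,\qquad w=\nabla\Theta\times\nabla x^3+w^3\,\partial_3\qquad\text{in }U.$$ If moreover $\nabla\chi\neq 0$ and $\xi=\nabla\times w$ in a neighborhood of $x$, then $U$, the coordinates, $\Theta$ and $w^3$ can be chosen so that, in addition,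 there are a smooth function $\Psi=\Psi(x^1,x^2)$ and a smooth function $\Phi=\Phi(x^1,x^2,x^3)$ on $U$ with $$w=\Psi\,\nabla\Theta+\nabla\Phi,\qquad \chi=-\Theta,\qquad \Psi_1\Theta_2-\Psi_2\Theta_1=1\qquad\text{in }U$$ (lower indices $1,2$ denote derivatives with respect to $x^1,x^2$), and $\Phi$ solves the generalized Grad–Shafranov equation $$-\frac{\nabla\Theta\times(\nabla\Phi\times\nabla\Theta)}{|\nabla\Theta|^2}\cdot\nabla\left(\frac{\nabla\Theta\cdot\nabla\Phi}{|\nabla\Theta|^2}\right)=1\qquad\text{in }U.$$ -/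

import Mathlib

open scoped ContDiff Matrix Topology

noncomputable section

namespace Magnetofluid

/-- Points and vectors of three-dimensional space in Cartesian coordinates. The Euclidean
inner product is the dot product `⬝ᵥ`, and the vector product is `⨯₃`. -/
abbrev Space : Type := Fin 3 → ℝ

/-- The Cartesian partial derivative `∂f/∂xᵢ` at `p`. -/
def pderiv (i : Fin 3) (f : Space → ℝ) (p : Space) : ℝ :=
  fderiv ℝ f p (Pi.single i 1)

/-- The gradient of a function. -/
def grad (f : Space → ℝ) (p : Space) : Space :=
  fun i => pderiv i f p

/-- The divergence of a vector field. -/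
def div (v : Space → Space) (p : Space) : ℝ :=
  ∑ i, pderiv i (fun q => v q i) p

/-- The curl of a vector field. -/
def curl (v : Space → Space) (p : Space) : Space :=
  ![pderiv 1 (fun q => v q 2) p - pderiv 2 (fun q => v q 1) p,
    pderiv 2 (fun q => v q 0) p - pderiv 0 (fun q => v q 2) p,
    pderiv 0 (fun q => v q 1) p - pderiv 1 (fun q => v q 0) p]

/-- `w` solves the magnetofluidostatic system `w × curl w = ∇χ`, `div w = 0` in `Ω`
with the (continuously differentiable) function `χ`. -/
structure IsSolution (Ω : Set Space) (w : Space → Space) (χ : Space → ℝ) : Prop where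
  contDiffOn_pressure : ContDiffOn ℝ 1 χ Ω
  force_balance : ∀ p ∈ Ω, w p ⨯₃ curl w p = grad χ p
  div_eq_zero : ∀ p ∈ Ω, div w p = 0

/-- `ξ` is a symmetry of the vector field `w` in `Ω`: the Lie derivative
`(ξ · ∇) w - (w · ∇) ξ` of `w` along `ξ` vanishes in `Ω`. -/
def IsSymmetry (Ω : Set Space) (ξ w : Space → Space) : Prop :=
  ∀ p ∈ Ω, VectorField.lieBracket ℝ ξ w p = 0

/-- A smooth curvilinear coordinate system `(x¹, x², x³)` on the open set `X.source`: a smooth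
map `X` onto an open set of coordinate values, with a smooth inverse. -/
def IsCoordinateSystem (X : OpenPartialHomeomorph Space Space) : Prop :=
  ContDiffOn ℝ ∞ X X.source ∧ ContDiffOn ℝ ∞ X.symm X.target

/-- The gradient `∇xⁱ` of a coordinate function (with indices `0, 1, 2`). -/
def gradCoord (X : OpenPartialHomeomorph Space Space) (i : Fin 3) (p : Space) : Space :=
  grad (fun q => X q i) p

/-- The coordinate tangent vector `∂ᵢ = ∂p/∂xⁱ` at the point `p` (with indices `0, 1, 2`). -/
def tangent (X : OpenPartialHomeomorph Space Space) (i : Fin 3) (p : Space) : Space :=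
  fderiv ℝ X.symm (X p) (Pi.single i 1)

/-- The values `(x¹, x²)` of the first two coordinates at the point `p`. -/
def firstTwo (X : OpenPartialHomeomorph Space Space) (p : Space) : ℝ × ℝ :=
  (X p 0, X p 1)

/-- The function `p ↦ F(x¹(p), x²(p))` on space given by a function `F` of `x¹` and `x²`. -/
def onSpace (X : OpenPartialHomeomorph Space Space) (F : ℝ × ℝ → ℝ) (p : Space) : ℝ :=
  F (firstTwo X p)

/-- `F` is a smooth function of the values of `(x¹, x²)` attained on the coordinate domain. -/
def SmoothOfFirstTwo (X : OpenPartialHomeomorph Space Space) (F : ℝ × ℝ → ℝ) : Prop :=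
  ContDiffOn ℝ ∞ F (firstTwo X '' X.source)

/-- The derivative of a function `F` of `(x¹, x²)` with respect to `x¹`. -/
def d₁ (F : ℝ × ℝ → ℝ) (s : ℝ × ℝ) : ℝ :=
  fderiv ℝ F s (1, 0)

/-- The derivative of a function `F` of `(x¹, x²)` with respect to `x²`. -/
def d₂ (F : ℝ × ℝ → ℝ) (s : ℝ × ℝ) : ℝ :=
  fderiv ℝ F s (0, 1)

/-- The component of `∇Φ` orthogonal to `∇Θ`, namely `∇Θ × (∇Φ × ∇Θ) / |∇Θ|²`. -/
def perpGrad (Θ Φ : Space → ℝ) (p : Space) : Space :=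
  (grad Θ p ⬝ᵥ grad Θ p)⁻¹ • (grad Θ p ⨯₃ (grad Φ p ⨯₃ grad Θ p))

/-- The generalized Grad–Shafranov equation at the point `p`:
`-(∇Θ × (∇Φ × ∇Θ) / |∇Θ|²) · ∇((∇Θ · ∇Φ) / |∇Θ|²) = 1`. -/
def GGSE (Θ Φ : Space → ℝ) (p : Space) : Prop :=
  -(perpGrad Θ Φ p ⬝ᵥ
    grad (fun q => (grad Θ q ⬝ᵥ grad Φ q) / (grad Θ q ⬝ᵥ grad Θ q)) p) = 1

end Magnetofluid

end

open scoped ContDiff Matrix Topology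

noncomputable section

/-! Since `w` and `ξ` commute and are divergence-free, `w ⨯₃ ξ` is curl-free (`curl_cross_eq_zero`),
so near `x` it is `-∇Θ` for some `Θ`. In coordinates straightening `ξ` to `∂₃`, invariance under `ξ`
means dependence on `x¹, x²` only (`IsAdapted.exists_onSpace_eq`). This applies to `Θ`, because `∇Θ
· ξ = 0`, and to the components of `w`, because `w` commutes with `ξ`. The representation of `w` is
then the triple product expansion of `(w ⨯₃ ξ) ⨯₃ ∇x³`.

If `ξ = curl w` and `∇χ ≠ 0`, then `∇χ = w ⨯₃ ξ`, so `Θ = -χ`, and `w`, `ξ` are independent. The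
projection of `w` to the `(x¹, x²)` plane is a nonvanishing planar field; straightening it gives `Ψ`
with `w · ∇Ψ = 1` and `ξ · ∇Ψ = 0` (`exists_conjugate_functions`). Hence `∇Ψ ⨯₃ ∇Θ = ξ = curl w`, so
`w - Ψ∇Θ` is curl-free and equals some `∇Φ`. Taking `(Ψ, Θ)` as the first two coordinates makes the
Jacobian condition trivial. As `w ⊥ ∇Θ`, the part of `∇Φ` orthogonal to `∇Θ` is `w` and the
coefficient along `∇Θ` is `-Ψ`, so the Grad–Shafranov equation reduces to `w · ∇Ψ = 1`.

Straightening rests on a smooth local flow (`exists_smooth_flow`), obtained by applying the inverse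
function theorem to the Picard map on `C([0,1], E)`. -/

namespace Magnetofluid

/-! ### Smoothness of composition operators on spaces of continuous functions. -/

section

variable {K E F : Type*} [TopologicalSpace K] [TopologicalSpace E] [TopologicalSpace F]

/-- Composition with a continuous map, as an operator between spaces of continuous functions. -/
def postcomp (g : E → F) (hg : Continuous g) (γ : C(K, E)) : C(K, F) :=
  (⟨g, hg⟩ : C(E, F)).comp γ

@[simp]
theorem postcomp_apply (g : E → F) (hg : Continuous g) (γ : C(K, E)) (s : K) :
    postcomp g hg γ s = g (γ s) := rfl

end

section Postcomp

universe u

variable {K E F : Type*} [TopologicalSpace K] [CompactSpace K]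
  [NormedAddCommGroup E] [NormedSpace ℝ E] [NormedAddCommGroup F] [NormedSpace ℝ F]

/-- Pointwise application of a continuous family of linear maps to a continuous function. -/
def pointwiseApply : C(K, E →L[ℝ] F) →L[ℝ] C(K, E) →L[ℝ] C(K, F) :=
  LinearMap.mkContinuous₂
    (LinearMap.mk₂ ℝ (fun (A : C(K, E →L[ℝ] F)) (h : C(K, E)) => (⟨fun s => A s (h s), by fun_prop⟩ : C(K, F)))
      (fun A B h => by ext; simp) (fun c A h => by ext; simp)
      (fun A h k => by ext; simp) (fun c A h => by ext; simp)) 1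
    (fun A h => by
      rw [ContinuousMap.norm_le _ (by positivity)]
      intro s
      simp only [LinearMap.mk₂_apply, ContinuousMap.coe_mk, one_mul]
      exact (A s).le_of_opNorm_le_of_le (A.norm_coe_le_norm s) (h.norm_coe_le_norm s))

@[simp]
theorem pointwiseApply_apply (A : C(K, E →L[ℝ] F)) (h : C(K, E)) (s : K) :
    pointwiseApply A h s = A s (h s) := rfl

/-- The range of `γ` is compact, so `fderiv ℝ g` varies by less than `ε` within a uniform distance
of it; the mean value inequality then bounds the remainder uniformly in `s`. -/
theorem hasFDerivAt_postcomp (g : E → F) (hg : ContDiff ℝ 1 g) (γ : C(K, E)) :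
    HasFDerivAt (postcomp (K := K) g hg.continuous)
      (pointwiseApply (postcomp (fderiv ℝ g) (hg.continuous_fderiv one_ne_zero) γ)) γ := by
  have hd : Differentiable ℝ g := hg.differentiable one_ne_zero
  have hc : Continuous (fderiv ℝ g) := hg.continuous_fderiv one_ne_zero
  rw [hasFDerivAt_iff_isLittleO_nhds_zero, Asymptotics.isLittleO_iff]
  intro ε hε
  have hK : IsCompact (Set.range γ) := isCompact_range γ.continuous
  have hu := hK.uniformContinuousAt_of_continuousAt (fderiv ℝ g)
    (fun a _ => hc.continuousAt) (Metric.dist_mem_uniformity hε)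
  obtain ⟨δ, hδ, hsub⟩ := Metric.mem_uniformity_dist.1 hu
  filter_upwards [Metric.ball_mem_nhds (0 : C(K, E)) hδ] with h hh
  rw [mem_ball_zero_iff] at hh
  rw [ContinuousMap.norm_le _ (by positivity)]
  intro s
  have hs : ‖h s‖ < δ := (h.norm_coe_le_norm s).trans_lt hh
  have key := (convex_ball (γ s) δ).norm_image_sub_le_of_norm_fderiv_le'
    (f := g) (φ := fderiv ℝ g (γ s)) (C := ε) (x := γ s) (y := γ s + h s) (𝕜 := ℝ)
    (fun x _ => hd x) (fun z hz => by
      have := hsub (a := γ s) (b := z) (by rwa [dist_comm]) ⟨s, rfl⟩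
      rw [← dist_eq_norm, dist_comm]
      exact le_of_lt this) (Metric.mem_ball_self hδ) (by simpa using hs)
  simp only [add_sub_cancel_left] at key
  exact key.trans (mul_le_mul_of_nonneg_left (h.norm_coe_le_norm s) hε.le)

/-- The derivative is a continuous linear map applied to `postcomp` of `fderiv ℝ g`, so induction
gains one order. The target changes to `E →L[ℝ] F` at each step, hence the quantification over
spaces in one universe. -/
theorem contDiff_postcomp_nat (n : ℕ) : ∀ {E F : Type u} [NormedAddCommGroup E] [NormedSpace ℝ E]
    [NormedAddCommGroup F] [NormedSpace ℝ F] (g : E → F) (hg : ContDiff ℝ ∞ g),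
    ContDiff ℝ n (postcomp (K := K) g hg.continuous) := by
  induction n with
  | zero =>
    intro E F _ _ _ _ g hg
    exact contDiff_zero.2 (ContinuousMap.continuous_postcomp _)
  | succ n ih =>
    intro E F _ _ _ _ g hg
    rw [Nat.cast_add_one, contDiff_succ_iff_hasFDerivAt]
    have hg' : ContDiff ℝ ∞ (fderiv ℝ g) := (contDiff_infty_iff_fderiv.1 hg).2
    refine ⟨fun γ => pointwiseApply (postcomp (fderiv ℝ g) hg'.continuous γ), ?_,
      hasFDerivAt_postcomp g (hg.of_le (by exact_mod_cast le_top))⟩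
    have h := ih (fderiv ℝ g) hg'
    exact (pointwiseApply (K := K) (E := E) (F := F)).contDiff.comp h

theorem contDiff_postcomp {E F : Type u} [NormedAddCommGroup E] [NormedSpace ℝ E]
    [NormedAddCommGroup F] [NormedSpace ℝ F] (g : E → F) (hg : ContDiff ℝ ∞ g) :
    ContDiff ℝ ∞ (postcomp (K := K) g hg.continuous) :=
  contDiff_infty.2 fun n => contDiff_postcomp_nat n g hg

end Postcomp

/-! ### Inverse function theorem. -/

section InverseFunction

variable {E F : Type*} [NormedAddCommGroup E] [NormedSpace ℝ E] [CompleteSpace E]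
  [NormedAddCommGroup F] [NormedSpace ℝ F]

/-- The smooth inverse function theorem on open sets. -/
theorem exists_smooth_openPartialHomeomorph {f : E → F} {Ω : Set E} (hΩ : IsOpen Ω)
    (hf : ContDiffOn ℝ ∞ f Ω) {x : E} (hx : x ∈ Ω) (A : E ≃L[ℝ] F) (hA : fderiv ℝ f x = A) :
    ∃ e : OpenPartialHomeomorph E F, (∀ p, e p = f p) ∧ x ∈ e.source ∧ e.source ⊆ Ω ∧
      ContDiffOn ℝ ∞ e.symm e.target ∧
      ∀ p ∈ e.source, ∃ B : E ≃L[ℝ] F, HasFDerivAt f (B : E →L[ℝ] F) p := by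
  have hfx : ContDiffAt ℝ ∞ f x := hf.contDiffAt (hΩ.mem_nhds hx)
  have hd : ∀ p ∈ Ω, HasFDerivAt f (fderiv ℝ f p) p := fun p hp =>
    ((hf.contDiffAt (hΩ.mem_nhds hp)).differentiableAt (by simp)).hasFDerivAt
  have hf' : HasFDerivAt f (A : E →L[ℝ] F) x := hA ▸ hd x hx
  let e₀ := hfx.toOpenPartialHomeomorph f hf' (by simp)
  -- Restricting to points with invertible derivative makes the inverse smooth on the whole target,
  -- not only at the image of `x`.
  let S : Set E := Ω ∩ fderiv ℝ f ⁻¹' Set.range ((↑) : (E ≃L[ℝ] F) → (E →L[ℝ] F))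
  have hS : IsOpen S := 
    ((contDiffOn_infty_iff_fderiv_of_isOpen hΩ).1 hf).2.continuousOn.isOpen_inter_preimage hΩ
      ContinuousLinearEquiv.isOpen
  have hB : ∀ p ∈ S, ∃ B : E ≃L[ℝ] F, HasFDerivAt f (B : E →L[ℝ] F) p := by
    rintro p ⟨hp, B, hB⟩
    exact ⟨B, hB ▸ hd p hp⟩
  have hsrc : (e₀.restrOpen S hS).source = e₀.source ∩ S := rfl
  refine ⟨e₀.restrOpen S hS, fun p => rfl, ?_, ?_, ?_, ?_⟩
  · rw [hsrc]
    exact ⟨hfx.mem_toOpenPartialHomeomorph_source hf' (by simp), hx, A, hA.symm⟩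
  · rw [hsrc]
    exact fun p hp => hp.2.1
  · intro y hy
    have hy' := (e₀.restrOpen S hS).map_target hy
    rw [hsrc] at hy'
    obtain ⟨B, hB⟩ := hB _ hy'.2
    exact ((e₀.restrOpen S hS).contDiffAt_symm hy hB
      (hf.contDiffAt (hΩ.mem_nhds hy'.2.1))).contDiffWithinAt
  · intro p hp
    rw [hsrc] at hp
    exact hB p hp.2

end InverseFunction

/-! ### Smooth local flows. -/

section Flow

variable {E : Type*} [NormedAddCommGroup E] [NormedSpace ℝ E]

/-- The primitive vanishing at `0` of a continuous function on the unit interval. -/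
def primitive : C(unitInterval, E) →L[ℝ] C(unitInterval, E) :=
  LinearMap.mkContinuous
    { toFun := fun γ => ⟨fun s => ∫ r in (0 : ℝ)..s, Set.IccExtend zero_le_one γ r, by
        have h : Continuous (Set.IccExtend zero_le_one γ) := γ.continuous.Icc_extend'
        exact (intervalIntegral.continuous_primitive (fun a b => h.intervalIntegrable a b) 0).comp
          continuous_subtype_val⟩
      map_add' := fun γ δ => by
        ext s
        exact intervalIntegral.integral_add (γ.continuous.Icc_extend'.intervalIntegrable _ _)
          (δ.continuous.Icc_extend'.intervalIntegrable _ _)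
      map_smul' := fun c γ => by
        ext s
        exact intervalIntegral.integral_smul c _ } 1
    (fun γ => by
      rw [ContinuousMap.norm_le _ (by positivity)]
      intro s
      refine (intervalIntegral.norm_integral_le_of_norm_le_const
        (C := ‖γ‖) fun r _ => γ.norm_coe_le_norm _).trans ?_
      rw [sub_zero, abs_of_nonneg s.2.1, one_mul]
      exact mul_le_of_le_one_right (norm_nonneg _) s.2.2)

/-- The time-rescaled Picard map, with parameters the initial point and the duration. -/
def picardMap (V : E → E) (hV : Continuous V) (z : (E × ℝ) × C(unitInterval, E)) : (E × ℝ) × C(unitInterval, E) :=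
  (z.1, z.2 - ContinuousLinearMap.const ℝ unitInterval z.1.1 - z.1.2 • primitive (postcomp V hV z.2))

/-- The derivative of `picardMap`. -/
def picardMapDeriv (V : E → E) (hV : ContDiff ℝ 1 V) (z : (E × ℝ) × C(unitInterval, E)) :
    (E × ℝ) × C(unitInterval, E) →L[ℝ] (E × ℝ) × C(unitInterval, E) :=
  (ContinuousLinearMap.fst ℝ _ _).prod
    (ContinuousLinearMap.snd ℝ _ _
      - (ContinuousLinearMap.const ℝ unitInterval).comp
          ((ContinuousLinearMap.fst ℝ E ℝ).comp (ContinuousLinearMap.fst ℝ _ _))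
      - (z.1.2 • (primitive.comp ((pointwiseApply
            (postcomp (fderiv ℝ V) (hV.continuous_fderiv one_ne_zero) z.2)).comp
              (ContinuousLinearMap.snd ℝ _ _)))
        + ((ContinuousLinearMap.snd ℝ E ℝ).comp (ContinuousLinearMap.fst ℝ _ _)).smulRight
            (primitive (postcomp V hV.continuous z.2))))

theorem hasFDerivAt_picardMap (V : E → E) (hV : ContDiff ℝ 1 V) (z : (E × ℝ) × C(unitInterval, E)) :
    HasFDerivAt (picardMap V hV.continuous) (picardMapDeriv V hV z) z := by
  have h1 : HasFDerivAt (fun z : (E × ℝ) × C(unitInterval, E) => primitive (postcomp V hV.continuous z.2))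
      (primitive.comp ((pointwiseApply
            (postcomp (fderiv ℝ V) (hV.continuous_fderiv one_ne_zero) z.2)).comp
              (ContinuousLinearMap.snd ℝ _ _))) z :=
    (primitive (E := E)).hasFDerivAt.comp z
      ((hasFDerivAt_postcomp V hV z.2).comp z hasFDerivAt_snd)
  have h2 : HasFDerivAt (fun z : (E × ℝ) × C(unitInterval, E) => z.1.2)
      ((ContinuousLinearMap.snd ℝ E ℝ).comp (ContinuousLinearMap.fst ℝ _ _)) z :=
    hasFDerivAt_snd.comp z hasFDerivAt_fst
  have h3 : HasFDerivAt (fun z : (E × ℝ) × C(unitInterval, E) => ContinuousLinearMap.const ℝ unitInterval z.1.1)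
      ((ContinuousLinearMap.const ℝ unitInterval).comp
          ((ContinuousLinearMap.fst ℝ E ℝ).comp (ContinuousLinearMap.fst ℝ _ _))) z :=
    (ContinuousLinearMap.const ℝ unitInterval (M := E)).hasFDerivAt.comp z
      (hasFDerivAt_fst.comp z hasFDerivAt_fst)
  exact hasFDerivAt_fst.prodMk ((hasFDerivAt_snd.sub h3).sub (h2.smul h1))

theorem contDiff_picardMap (V : E → E) (hV : ContDiff ℝ ∞ V) :
    ContDiff ℝ ∞ (picardMap V hV.continuous) := by
  have h1 : ContDiff ℝ ∞
      (fun z : (E × ℝ) × C(unitInterval, E) => primitive (postcomp V hV.continuous z.2)) :=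
    (primitive (E := E)).contDiff.comp ((contDiff_postcomp V hV).comp contDiff_snd)
  have h3 : ContDiff ℝ ∞ (fun z : (E × ℝ) × C(unitInterval, E) => ContinuousLinearMap.const ℝ unitInterval z.1.1) :=
    (ContinuousLinearMap.const ℝ unitInterval (M := E)).contDiff.comp
      (contDiff_fst.comp contDiff_fst)
  exact contDiff_fst.prodMk
    ((contDiff_snd.sub h3).sub ((contDiff_snd.comp contDiff_fst).smul h1))

/-- Along a solution of the rescaled integral equation, `s ↦ s • V (γ s)` solves the equation
obtained by differentiating with respect to the duration. -/
theorem smul_comp_eq_primitive [CompleteSpace E] (V : E → E) (hV : ContDiff ℝ 1 V) (p : E) (t : ℝ) (γ : C(unitInterval, E))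
    (hγ : γ = ContinuousLinearMap.const ℝ unitInterval p + t • primitive (postcomp V hV.continuous γ))
    (k : C(unitInterval, E)) (hk : ∀ s : unitInterval, k s = (s : ℝ) • V (γ s)) :
    k = primitive (postcomp V hV.continuous γ) + t • primitive (pointwiseApply
      (postcomp (fderiv ℝ V) (hV.continuous_fderiv one_ne_zero) γ) k) := by
  set g : ℝ → E := Set.IccExtend zero_le_one γ
  have hg : Continuous g := γ.continuous.Icc_extend'
  have hVg : Continuous fun r => V (g r) := hV.continuous.comp hg
  have hVd : Differentiable ℝ V := hV.differentiable one_ne_zero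
  -- `u` agrees with `γ` on the unit interval and is differentiable on all of `ℝ`, so two-sided
  -- derivatives exist at the endpoints.
  let u : ℝ → E := fun s => p + t • ∫ r in (0 : ℝ)..s, V (g r)
  have hu : ∀ s, HasDerivAt u (t • V (g s)) s := fun s =>
    ((intervalIntegral.integral_hasDerivAt_right (hVg.intervalIntegrable _ _)
      (hVg.stronglyMeasurableAtFilter _ _) hVg.continuousAt).const_smul t).const_add p
  have hug : ∀ s : unitInterval, u s = γ s := fun s => by
    conv_rhs => rw [hγ]
    rfl
  have hgI : ∀ s : unitInterval, g s = γ s := fun s => Set.IccExtend_val _ _ s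
  ext s
  have hder : ∀ r ∈ Set.uIcc (0 : ℝ) s, HasDerivAt (fun r : ℝ => r • V (u r))
      (V (g r) + t • Set.IccExtend zero_le_one (pointwiseApply
        (postcomp (fderiv ℝ V) (hV.continuous_fderiv one_ne_zero) γ) k) r) r := by
    intro r hr
    rw [Set.uIcc_of_le s.2.1] at hr
    have hrI : r ∈ unitInterval := ⟨hr.1, hr.2.trans s.2.2⟩
    have h1 := (hasDerivAt_id r).smul ((hVd (u r)).hasFDerivAt.comp_hasDerivAt r (hu r))
    refine h1.congr_deriv ?_
    have h2 := hug ⟨r, hrI⟩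
    have h3 := hgI ⟨r, hrI⟩
    simp only at h2 h3
    rw [Set.IccExtend_of_mem _ _ hrI, pointwiseApply_apply, hk, h2, h3, postcomp_apply]
    simp only [Function.comp_apply, h2, id, map_smul, one_smul]
    rw [smul_comm t r, add_comm]
  have hc1 : Continuous (Set.IccExtend zero_le_one (pointwiseApply
        (postcomp (fderiv ℝ V) (hV.continuous_fderiv one_ne_zero) γ) k)) :=
    (ContinuousMap.continuous _).Icc_extend'
  have hc2 : Continuous fun r => t • Set.IccExtend zero_le_one (pointwiseApply
        (postcomp (fderiv ℝ V) (hV.continuous_fderiv one_ne_zero) γ) k) r := hc1.const_smul t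
  have hint := intervalIntegral.integral_eq_sub_of_hasDerivAt hder
    ((hVg.add hc2).intervalIntegrable _ _)
  rw [intervalIntegral.integral_add (hVg.intervalIntegrable _ _)
    (hc2.intervalIntegrable _ _), intervalIntegral.integral_smul, hug s,
    zero_smul, sub_zero] at hint
  rw [hk, ← hint]
  rfl

/-- A smooth vector field has a smooth local flow. -/
theorem exists_smooth_flow [CompleteSpace E] (V : E → E) (hV : ContDiff ℝ ∞ V) (x : E) :
    ∃ (N : Set (E × ℝ)) (φ : E × ℝ → E), IsOpen N ∧ (x, 0) ∈ N ∧ ContDiffOn ℝ ∞ φ N ∧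
      (∀ p, (p, (0 : ℝ)) ∈ N → φ (p, 0) = p) ∧
      ∀ q ∈ N, HasDerivAt (fun t => φ (q.1, t)) (V (φ q)) q.2 := by
  have hV1 : ContDiff ℝ 1 V := hV.of_le (by exact_mod_cast le_top)
  let z₀ : (E × ℝ) × C(unitInterval, E) := ((x, 0), ContinuousLinearMap.const ℝ unitInterval x)
  -- At duration `0` the integral term contributes nothing in the path direction, so the derivative
  -- is triangular with identities on the diagonal.
  let A : ((E × ℝ) × C(unitInterval, E)) ≃L[ℝ] (E × ℝ) × C(unitInterval, E) :=
    (ContinuousLinearEquiv.refl ℝ (E × ℝ)).skewProd (ContinuousLinearEquiv.refl ℝ C(unitInterval, E))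
      (-(ContinuousLinearMap.const ℝ unitInterval).comp (ContinuousLinearMap.fst ℝ E ℝ)
        - (ContinuousLinearMap.snd ℝ E ℝ).smulRight
            (primitive (postcomp V hV.continuous z₀.2)))
  have hA : fderiv ℝ (picardMap V hV.continuous) z₀ = A := by
    rw [(hasFDerivAt_picardMap V hV1 z₀).fderiv]
    refine ContinuousLinearMap.ext fun z => ?_
    refine Prod.ext rfl ?_
    simp [picardMapDeriv, A, z₀]
    abel
  obtain ⟨e, he, hz₀, -, hsymm, hinv⟩ := exists_smooth_openPartialHomeomorph isOpen_univ
    (contDiff_picardMap V hV).contDiffOn (Set.mem_univ z₀) A hA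
  let j : E × ℝ → (E × ℝ) × C(unitInterval, E) := fun q => (q, 0)
  have hj : ContDiff ℝ ∞ j := contDiff_id.prodMk contDiff_const
  let N : Set (E × ℝ) := j ⁻¹' e.target
  have hN : IsOpen N := e.open_target.preimage hj.continuous
  -- Zeros of the path component are rescaled trajectories: `Γ (p, t)` at `s` is the flow of `p` at
  -- time `s * t`. Evaluation at `s = 1` gives the flow.
  let Γ : E × ℝ → C(unitInterval, E) := fun q => (e.symm (j q)).2
  have hΓ : ContDiffOn ℝ ∞ Γ N := contDiff_snd.comp_contDiffOn
    (hsymm.comp hj.contDiffOn (Set.mapsTo_preimage j e.target))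
  have heq : ∀ q ∈ N, e.symm (j q) = (q, Γ q) ∧
      Γ q = ContinuousLinearMap.const ℝ unitInterval q.1 +
        q.2 • primitive (postcomp V hV.continuous (Γ q)) := by
    intro q hq
    have h1 : picardMap V hV.continuous (e.symm (j q)) = (q, 0) :=
      (he _).symm.trans (e.right_inv hq)
    have h2 : (e.symm (j q)).1 = q := congrArg Prod.fst h1
    refine ⟨Prod.ext h2 rfl, ?_⟩
    have h3 : Γ q - ContinuousLinearMap.const ℝ unitInterval (e.symm (j q)).1.1
      - (e.symm (j q)).1.2 • primitive (postcomp V hV.continuous (Γ q)) = 0 :=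
        congrArg Prod.snd h1
    rw [h2, sub_sub, sub_eq_zero] at h3
    exact h3
  have hz₀' : picardMap V hV.continuous z₀ = j (x, 0) := by
    simp [picardMap, z₀, j]
  have hxN : (x, (0 : ℝ)) ∈ N := by
    have := e.map_source hz₀
    rwa [he, hz₀'] at this
  refine ⟨N, fun q => Γ q 1, hN, hxN,
    (ContinuousMap.evalCLM ℝ (M := E) (1 : unitInterval)).contDiff.comp_contDiffOn hΓ, ?_, ?_⟩
  · intro p hp
    have := (heq _ hp).2
    simp only [zero_smul, add_zero] at this
    exact congrArg (fun γ : C(unitInterval, E) => γ 1) this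
  · intro q hq
    have hΓd : HasFDerivAt Γ (fderiv ℝ Γ q) q :=
      ((hΓ.contDiffAt (hN.mem_nhds hq)).differentiableAt (by simp)).hasFDerivAt
    have hline : HasDerivAt (fun t : ℝ => (q.1, t)) ((0 : E), (1 : ℝ)) q.2 :=
      (hasDerivAt_const _ _).prodMk (hasDerivAt_id _)
    have hD : HasDerivAt (fun t => Γ (q.1, t)) (fderiv ℝ Γ q (0, 1)) q.2 :=
      HasFDerivAt.comp_hasDerivAt q.2 (f := fun t : ℝ => (q.1, t)) hΓd hline
    set D := fderiv ℝ Γ q (0, 1)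
    let k : C(unitInterval, E) := ⟨fun s => (s : ℝ) • V (Γ q s),
      continuous_subtype_val.smul (hV.continuous.comp (Γ q).continuous)⟩
    have hk := smul_comp_eq_primitive V hV1 q.1 q.2 (Γ q) (heq q hq).2 k fun s => rfl
    have hDeq : D = primitive (postcomp V hV.continuous (Γ q)) + q.2 • primitive (pointwiseApply
        (postcomp (fderiv ℝ V) (hV1.continuous_fderiv one_ne_zero) (Γ q)) D) := by
      have hP : HasDerivAt (fun t => primitive (postcomp V hV.continuous (Γ (q.1, t))))
          (primitive (pointwiseApply
            (postcomp (fderiv ℝ V) (hV1.continuous_fderiv one_ne_zero) (Γ q)) D)) q.2 :=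
        (primitive (E := E)).hasFDerivAt.comp_hasDerivAt q.2
          (HasFDerivAt.comp_hasDerivAt (f := fun t => Γ (q.1, t)) q.2
            (hasFDerivAt_postcomp V hV1 (Γ q)) hD)
      have hR := ((hasDerivAt_id q.2).smul hP).const_add (ContinuousLinearMap.const ℝ unitInterval q.1)
      have hev : (fun t => Γ (q.1, t)) =ᶠ[𝓝 q.2] fun t => ContinuousLinearMap.const ℝ unitInterval q.1 +
          id t • primitive (postcomp V hV.continuous (Γ (q.1, t))) := by
        have : ∀ᶠ t in 𝓝 q.2, (q.1, t) ∈ N :=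
          hline.continuousAt.eventually (hN.mem_nhds hq)
        filter_upwards [this] with t ht using (heq _ ht).2
      have := hD.unique (hR.congr_of_eventuallyEq hev)
      rw [one_smul, add_comm] at this
      exact this
    -- Both solve the same linearized equation, and the derivative of the Picard map at `(q, Γ q)`
    -- is injective. Evaluating at `1` then yields the flow equation.
    have hkD : D = k := by
      obtain ⟨B, hB⟩ := hinv _ (e.map_target hq)
      rw [(heq q hq).1] at hB
      have hB' := hB.unique (hasFDerivAt_picardMap V hV1 (q, Γ q))
      have : B ((0 : E × ℝ), D - k) = 0 := by
        change (B : (E × ℝ) × C(unitInterval, E) →L[ℝ] (E × ℝ) × C(unitInterval, E)) (0, D - k) = 0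
        rw [hB']
        refine Prod.ext rfl ?_
        simp only [picardMapDeriv, ContinuousLinearMap.prod_apply, sub_apply,
          add_apply, smul_apply,
          ContinuousLinearMap.comp_apply, ContinuousLinearMap.smulRight_apply,
          ContinuousLinearMap.coe_fst', ContinuousLinearMap.coe_snd', map_zero,
          Prod.snd_zero, zero_smul, add_zero, sub_zero, map_sub, smul_sub]
        nth_rewrite 1 [hDeq, hk]
        abel
      have := congrArg Prod.snd ((map_eq_zero_iff B B.injective).1 this)
      exact sub_eq_zero.1 this
    have := (ContinuousMap.evalCLM ℝ (M := E) (1 : unitInterval)).hasFDerivAt.comp_hasDerivAt q.2 hD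
    rw [hkD] at this
    simpa [k, Function.comp_def] using this

end Flow

/-! ### Straightening a nonvanishing field. -/

section Rectification

variable {E : Type*} [NormedAddCommGroup E] [NormedSpace ℝ E] [FiniteDimensional ℝ E]

/-- A smooth vector field on an open set agrees near each point with a globally smooth one. -/
theorem exists_contDiff_eqOn {F : Type*} [NormedAddCommGroup F] [NormedSpace ℝ F]
    {Ω : Set E} (hΩ : IsOpen Ω) {V : E → F} (hV : ContDiffOn ℝ ∞ V Ω) {x : E} (hx : x ∈ Ω) :
    ∃ (W : E → F) (O : Set E), ContDiff ℝ ∞ W ∧ IsOpen O ∧ x ∈ O ∧ O ⊆ Ω ∧ Set.EqOn W V O := by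
  obtain ⟨ε, hε, hsub⟩ := Metric.isOpen_iff.1 hΩ x hx
  let b : ContDiffBump x := ⟨ε / 4, ε / 2, by positivity, by linarith⟩
  refine ⟨fun p => b p • V p, Metric.ball x (ε / 4), ?_, Metric.isOpen_ball,
    Metric.mem_ball_self (by positivity),
    (Metric.ball_subset_ball (by linarith)).trans hsub, ?_⟩
  · refine contDiff_iff_contDiffAt.2 fun p => ?_
    by_cases hp : p ∈ tsupport fun p => b p • V p
    swap
    · exact contDiffAt_const.congr_of_eventuallyEq (notMem_tsupport_iff_eventuallyEq.1 hp)
    have hp' : p ∈ Metric.closedBall x (ε / 2) := by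
      have := (tsupport_smul_subset_left (fun p => b p) V) hp
      rwa [b.tsupport_eq] at this
    have hpΩ : p ∈ Ω := hsub (Metric.closedBall_subset_ball (by linarith) hp')
    exact b.contDiff.contDiffAt.smul (hV.contDiffAt (hΩ.mem_nhds hpΩ))
  · intro p hp
    have : b p = 1 := b.one_of_mem_closedBall (Metric.ball_subset_closedBall hp)
    simp [this]

/-- Rectification of a smooth vector field near a point where it does not vanish. -/
theorem exists_rectification {Ω : Set E} (hΩ : IsOpen Ω) {V : E → E} (hV : ContDiffOn ℝ ∞ V Ω)
    {x : E} (hx : x ∈ Ω) (hVx : V x ≠ 0) :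
    ∃ (N : Set E) (ψ : E → E), IsOpen N ∧ x ∈ N ∧ N ⊆ Ω ∧ ContDiffOn ℝ ∞ ψ N ∧
      fderiv ℝ ψ x = ContinuousLinearMap.id ℝ E ∧ ∀ p ∈ N, fderiv ℝ ψ p (V p) = V x := by
  have : CompleteSpace E := FiniteDimensional.complete ℝ E
  obtain ⟨W, O, hW, hO, hxO, hOΩ, hWV⟩ := exists_contDiff_eqOn hΩ hV hx
  obtain ⟨M, φ, hM, hxM, hφ, hφ0, hφt⟩ := exists_smooth_flow W hW x
  obtain ⟨f, hf⟩ := SeparatingDual.exists_eq_one (R := ℝ) hVx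
  -- Splits a displacement into its part in `ker f`, transverse to `V x`, and a flow time. `G` flows
  -- from the hyperplane through `x` for that time and carries the constant field `V x` to `W`; its
  -- inverse is the required `ψ`.
  let L : E →L[ℝ] E × ℝ := (ContinuousLinearMap.id ℝ E - f.smulRight (V x)).prod f
  let a : E → E × ℝ := fun y => L (y - x) + (x, 0)
  have ha : ContDiff ℝ ∞ a := (L.contDiff.comp (contDiff_id.sub contDiff_const)).add contDiff_const
  have ha' : ∀ y, HasFDerivAt a L y := fun y =>
    (L.hasFDerivAt.comp y ((hasFDerivAt_id y).sub_const x)).add_const (x, (0 : ℝ))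
  have hax : a x = (x, 0) := by simp [a]
  let G : E → E := φ ∘ a
  have hG : ContDiffOn ℝ ∞ G (a ⁻¹' M) :=
    hφ.comp ha.contDiffOn (Set.mapsTo_preimage a M)
  have hφd : ∀ q ∈ M, HasFDerivAt φ (fderiv ℝ φ q) q := fun q hq =>
    ((hφ.contDiffAt (hM.mem_nhds hq)).differentiableAt (by simp)).hasFDerivAt
  have hGd : ∀ y ∈ a ⁻¹' M, HasFDerivAt G ((fderiv ℝ φ (a y)).comp L) y := fun y hy =>
    (hφd (a y) hy).comp y (ha' y)
  have hφt' : ∀ q ∈ M, fderiv ℝ φ q (0, 1) = W (φ q) := fun q hq => by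
    have hline : HasDerivAt (fun t : ℝ => (q.1, t)) ((0 : E), (1 : ℝ)) q.2 :=
      (hasDerivAt_const _ _).prodMk (hasDerivAt_id _)
    exact (HasFDerivAt.comp_hasDerivAt q.2 (f := fun t : ℝ => (q.1, t)) (hφd q hq) hline).unique
      (hφt q hq)
  have hLV : L (V x) = (0, 1) := by simp [L, hf]
  have hGV : ∀ y ∈ a ⁻¹' M, fderiv ℝ G y (V x) = W (G y) := fun y hy => by
    rw [(hGd y hy).fderiv, ContinuousLinearMap.comp_apply, hLV, hφt' _ hy]
    rfl
  have hxM' : x ∈ a ⁻¹' M := by rwa [Set.mem_preimage, hax]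
  have hGx : G x = x := by
    change φ (a x) = x
    rw [hax, hφ0 x hxM]
  have hφx : ∀ h : E, fderiv ℝ φ (x, 0) (h, 0) = h := fun h => by
    have h1 : HasFDerivAt (fun p : E => φ (p, 0))
        ((fderiv ℝ φ (x, 0)).comp (ContinuousLinearMap.inl ℝ E ℝ)) x :=
      HasFDerivAt.comp (f := fun p : E => (p, (0 : ℝ))) x (hφd (x, 0) hxM)
        (hasFDerivAt_prodMk_left x 0)
    have hev : (fun p : E => φ (p, 0)) =ᶠ[𝓝 x] id := by
      have : ∀ᶠ p in 𝓝 x, (p, (0 : ℝ)) ∈ M :=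
        (Continuous.prodMk_left (0 : ℝ)).continuousAt.eventually (hM.mem_nhds hxM)
      filter_upwards [this] with p hp using hφ0 p hp
    have h2 := h1.unique ((hasFDerivAt_id x).congr_of_eventuallyEq hev)
    simpa using congrArg (fun A : E →L[ℝ] E => A h) h2
  have hGid : fderiv ℝ G x = (ContinuousLinearEquiv.refl ℝ E : E →L[ℝ] E) := by
    rw [(hGd x hxM').fderiv, hax]
    refine ContinuousLinearMap.ext fun h => ?_
    have hsplit : L h = (h - f h • V x, 0) + f h • ((0 : E), (1 : ℝ)) := by simp [L]
    rw [ContinuousLinearMap.comp_apply, hsplit, map_add, map_smul, hφx, hφt' _ hxM, hφ0 x hxM,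
      hWV hxO]
    simp
  obtain ⟨e, he, hxe, hesub, hsymm, hinv⟩ := exists_smooth_openPartialHomeomorph
    (hM.preimage ha.continuous) hG hxM' _ hGid
  have hex : x ∈ e.target := by
    have := e.map_source hxe
    rwa [he, hGx] at this
  have hesx : e.symm x = x := by
    have := e.left_inv hxe
    rwa [he, hGx] at this
  have hcomp : ∀ p ∈ e.target, (fderiv ℝ e.symm p).comp (fderiv ℝ G (e.symm p)) =
      ContinuousLinearMap.id ℝ E := fun p hp => by
    have hy := e.map_target hp
    have hp' : G (e.symm p) = p := by rw [← he, e.right_inv hp]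
    have h1 : HasFDerivAt e.symm (fderiv ℝ e.symm p) (G (e.symm p)) := by
      rw [hp']
      exact ((hsymm.contDiffAt (e.open_target.mem_nhds hp)).differentiableAt (by simp)).hasFDerivAt
    have h2 := h1.comp (e.symm p) (hGd _ (hesub hy)).differentiableAt.hasFDerivAt
    have hev : e.symm ∘ G =ᶠ[𝓝 (e.symm p)] id := by
      filter_upwards [e.open_source.mem_nhds hy] with z hz
      rw [Function.comp_apply, ← he, e.left_inv hz, id]
    exact h2.unique ((hasFDerivAt_id _).congr_of_eventuallyEq hev)
  refine ⟨e.target ∩ O, e.symm, e.open_target.inter hO, ⟨hex, hxO⟩, fun p hp => hOΩ hp.2,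
    hsymm.mono Set.inter_subset_left, ?_, ?_⟩
  · have := hcomp x hex
    rw [hesx, hGid] at this
    exact this
  · rintro p ⟨hp, hpO⟩
    have h1 := hGV _ (hesub (e.map_target hp))
    rw [← he, e.right_inv hp, hWV hpO] at h1
    rw [← h1, ← ContinuousLinearMap.comp_apply, hcomp p hp]
    rfl

end Rectification

/-! ### Gradient, curl and the Poincaré lemma. -/

section VectorCalculus

theorem fderiv_apply_eq_grad_dotProduct (f : Space → ℝ) (p v : Space) :
    fderiv ℝ f p v = grad f p ⬝ᵥ v := by
  conv_lhs => rw [pi_eq_sum_univ' v]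
  simp [map_sum, dotProduct, grad, pderiv, mul_comm]

theorem grad_congr {f g : Space → ℝ} {p : Space} (h : f =ᶠ[𝓝 p] g) : grad f p = grad g p := by
  funext i
  simp only [grad, pderiv, h.fderiv_eq]

theorem fderiv_apply_component {v : Space → Space} {p : Space} (hv : DifferentiableAt ℝ v p)
    (h : Space) (i : Fin 3) : fderiv ℝ v p h i = fderiv ℝ (fun q => v q i) p h := by
  rw [fderiv_apply hv i]
  rfl

theorem contDiffOn_component {v : Space → Space} {s : Set Space} (hv : ContDiffOn ℝ ∞ v s)
    (i : Fin 3) : ContDiffOn ℝ ∞ (fun q => v q i) s :=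
  contDiffOn_pi.1 hv i

theorem ContDiffOn.pderiv {f : Space → ℝ} {s : Set Space} (hs : IsOpen s)
    (hf : ContDiffOn ℝ ∞ f s) (i : Fin 3) : ContDiffOn ℝ ∞ (pderiv i f) s :=
  ((contDiffOn_infty_iff_fderiv_of_isOpen hs).1 hf).2.clm_apply contDiffOn_const

theorem ContDiffOn.grad {f : Space → ℝ} {s : Set Space} (hs : IsOpen s)
    (hf : ContDiffOn ℝ ∞ f s) : ContDiffOn ℝ ∞ (grad f) s :=
  contDiffOn_pi.2 fun i => ContDiffOn.pderiv hs hf i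

theorem contDiffOn_cross {u v : Space → Space} {s : Set Space}
    (hu : ContDiffOn ℝ ∞ u s) (hv : ContDiffOn ℝ ∞ v s) :
    ContDiffOn ℝ ∞ (fun q => u q ⨯₃ v q) s := by
  have h : ∀ i j, ContDiffOn ℝ ∞ (fun q => u q i * v q j - u q j * v q i) s := fun i j =>
    ((contDiffOn_component hu i).mul (contDiffOn_component hv j)).sub
      ((contDiffOn_component hu j).mul (contDiffOn_component hv i))
  refine contDiffOn_pi.2 fun i => ?_
  fin_cases i
  · simpa [cross_apply] using h 1 2
  · simpa [cross_apply] using h 2 0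
  · simpa [cross_apply] using h 0 1

/-- The dot product as a continuous linear map into functionals. -/
def dotProductCLM : Space →L[ℝ] Space →L[ℝ] ℝ :=
  LinearMap.toContinuousLinearMap
    (LinearMap.toContinuousLinearMap.toLinearMap.comp (dotProductBilin ℝ ℝ))

@[simp]
theorem dotProductCLM_apply (u v : Space) : dotProductCLM u v = u ⬝ᵥ v := rfl

theorem contDiffOn_of_hasFDerivAt_dotProduct {f : Space → ℝ} {u : Space → Space} {s : Set Space}
    (hs : IsOpen s) (hu : ContDiffOn ℝ ∞ u s)
    (hf : ∀ p ∈ s, HasFDerivAt f (dotProductCLM (u p)) p) : ContDiffOn ℝ ∞ f s := by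
  refine (contDiffOn_infty_iff_fderiv_of_isOpen hs).2
    ⟨fun p hp => (hf p hp).differentiableAt.differentiableWithinAt, ?_⟩
  exact (dotProductCLM.contDiff.comp_contDiffOn hu).congr fun p hp => (hf p hp).fderiv

theorem hasFDerivAt_dotProduct_grad {f : Space → ℝ} {p : Space} (hf : DifferentiableAt ℝ f p) :
    HasFDerivAt f (dotProductCLM (grad f p)) p := by
  convert hf.hasFDerivAt using 1
  ext1 v
  exact (fderiv_apply_eq_grad_dotProduct f p v).symm

theorem grad_eq_of_hasFDerivAt {f : Space → ℝ} {u p : Space}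
    (hf : HasFDerivAt f (dotProductCLM u) p) : grad f p = u := by
  funext i
  simp [grad, pderiv, hf.fderiv]

/-- The Poincaré lemma for smooth curl-free fields on convex open sets. -/
theorem exists_grad_eq_of_curl_eq_zero {u : Space → Space} {s : Set Space} (hs : IsOpen s)
    (hsc : Convex ℝ s) (hu : ContDiffOn ℝ ∞ u s) (hcurl : ∀ p ∈ s, curl u p = 0) :
    ∃ f : Space → ℝ, ContDiffOn ℝ ∞ f s ∧ ∀ p ∈ s, grad f p = u p := by
  have hud : ∀ p ∈ s, DifferentiableAt ℝ u p := fun p hp =>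
    (hu.contDiffAt (hs.mem_nhds hp)).differentiableAt (by simp)
  have hω : ∀ p ∈ s, HasFDerivAt (fun q => dotProductCLM (u q))
      (dotProductCLM.comp (fderiv ℝ u p)) p := fun p hp =>
    dotProductCLM.hasFDerivAt.comp p (hud p hp).hasFDerivAt
  obtain ⟨f, hf⟩ := hsc.exists_forall_hasFDerivAt_of_fderiv_symmetric hs
    (fun p hp => (hω p hp).differentiableAt.differentiableWithinAt) (fun p hp a b => by
      have hc := hcurl p hp
      have h0 := congrFun hc 0
      have h1 := congrFun hc 1
      have h2 := congrFun hc 2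
      simp only [curl, Matrix.cons_val, Pi.zero_apply] at h0 h1 h2
      rw [(hω p hp).fderiv]
      simp only [ContinuousLinearMap.comp_apply, dotProductCLM_apply, dotProduct,
        fderiv_apply_component (hud p hp), fderiv_apply_eq_grad_dotProduct, Fin.sum_univ_three,
        grad]
      -- The antisymmetric part of the derivative, evaluated on `a` and `b`, is `curl u · (a ⨯₃ b)`.
      linear_combination (a 1 * b 2 - a 2 * b 1) * h0 + (a 2 * b 0 - a 0 * b 2) * h1
        + (a 0 * b 1 - a 1 * b 0) * h2)
  exact ⟨f, contDiffOn_of_hasFDerivAt_dotProduct hs hu hf, fun p hp =>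
    grad_eq_of_hasFDerivAt (hf p hp)⟩

theorem pderiv_sub {f g : Space → ℝ} {p : Space} (hf : DifferentiableAt ℝ f p)
    (hg : DifferentiableAt ℝ g p) (i : Fin 3) :
    pderiv i (fun q => f q - g q) p = pderiv i f p - pderiv i g p := by
  simp only [pderiv, fderiv_fun_sub hf hg, sub_apply]

theorem pderiv_mul {f g : Space → ℝ} {p : Space} (hf : DifferentiableAt ℝ f p)
    (hg : DifferentiableAt ℝ g p) (i : Fin 3) :
    pderiv i (fun q => f q * g q) p = f p * pderiv i g p + g p * pderiv i f p := by
  simp [pderiv, fderiv_fun_mul hf hg]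

theorem pderiv_neg (f : Space → ℝ) (p : Space) (i : Fin 3) :
    pderiv i (fun q => -f q) p = -pderiv i f p := by
  simp [pderiv, fderiv_fun_neg]

theorem grad_neg (f : Space → ℝ) (p : Space) : grad (fun q => -f q) p = -grad f p := by
  funext i
  exact pderiv_neg f p i

theorem curl_neg (u : Space → Space) (p : Space) : curl (fun q => -u q) p = -curl u p := by
  funext i
  fin_cases i <;> simp [curl, pderiv_neg] <;> ring

theorem pderiv_comm {f : Space → ℝ} {p : Space} (hf : ContDiffAt ℝ ∞ f p) (i j : Fin 3) :
    pderiv i (pderiv j f) p = pderiv j (pderiv i f) p := by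
  have hd : DifferentiableAt ℝ (fderiv ℝ f) p :=
    (hf.fderiv_right (m := ∞) (by simp)).differentiableAt (by simp)
  have h : ∀ i j : Fin 3, pderiv i (pderiv j f) p =
      fderiv ℝ (fderiv ℝ f) p (Pi.single i 1) (Pi.single j 1) := fun i j => by
    have : HasFDerivAt (pderiv j f)
        ((ContinuousLinearMap.apply ℝ ℝ (Pi.single j (1 : ℝ) : Space)).comp
          (fderiv ℝ (fderiv ℝ f) p)) p :=
      (ContinuousLinearMap.apply ℝ ℝ (Pi.single j (1 : ℝ) : Space)).hasFDerivAt.comp p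
        hd.hasFDerivAt
    rw [pderiv, this.fderiv]
    rfl
  have hsymm : IsSymmSndFDerivAt ℝ f p := hf.isSymmSndFDerivAt (by
    rw [minSmoothness_of_isRCLikeNormedField]
    exact WithTop.coe_le_coe.2 le_top)
  rw [h, h, hsymm]

/-- The vector product of commuting divergence-free fields is curl-free. -/
theorem curl_cross_eq_zero {u v : Space → Space} {p : Space} (hu : DifferentiableAt ℝ u p)
    (hv : DifferentiableAt ℝ v p) (hu_div : div u p = 0) (hv_div : div v p = 0)
    (hbr : VectorField.lieBracket ℝ v u p = 0) : curl (fun q => u q ⨯₃ v q) p = 0 := by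
  have hud : ∀ i, DifferentiableAt ℝ (fun q => u q i) p := differentiableAt_pi.1 hu
  have hvd : ∀ i, DifferentiableAt ℝ (fun q => v q i) p := differentiableAt_pi.1 hv
  have hm : ∀ i j k, pderiv k (fun q => u q i * v q j - u q j * v q i) p =
      u p i * pderiv k (fun q => v q j) p + v p j * pderiv k (fun q => u q i) p
        - (u p j * pderiv k (fun q => v q i) p + v p i * pderiv k (fun q => u q j) p) :=
    fun i j k => by
      rw [pderiv_sub ((hud i).fun_mul (hvd j)) ((hud j).fun_mul (hvd i)),
        pderiv_mul (hud i) (hvd j), pderiv_mul (hud j) (hvd i)]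
  have hb : ∀ k, (∑ j, pderiv j (fun q => u q k) p * v p j)
      - ∑ j, pderiv j (fun q => v q k) p * u p j = 0 := fun k => by
    have := congrFun hbr k
    rwa [VectorField.lieBracket, Pi.sub_apply, fderiv_apply_component hu,
      fderiv_apply_component hv, fderiv_apply_eq_grad_dotProduct,
      fderiv_apply_eq_grad_dotProduct] at this
  simp only [div, Fin.sum_univ_three] at hu_div hv_div hb
  -- This is `curl (u ⨯₃ v) = (div v) u - (div u) v + (v · ∇) u - (u · ∇) v`, read componentwise.
  funext k
  have := hb k
  fin_cases k <;>
    simp only [curl, cross_apply, Matrix.cons_val, hm, Pi.zero_apply, Fin.zero_eta, Fin.mk_one,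
      Fin.reduceFinMk] at this ⊢
  · linear_combination u p 0 * hv_div - v p 0 * hu_div + this
  · linear_combination u p 1 * hv_div - v p 1 * hu_div + this
  · linear_combination u p 2 * hv_div - v p 2 * hu_div + this

/-- Symmetry of second derivatives of `g` leaves only `∇f ⨯₃ ∇g` in the curl of `f ∇g`. -/
theorem curl_sub_smul_grad {u : Space → Space} {f g : Space → ℝ} {p : Space}
    (hu : DifferentiableAt ℝ u p) (hf : DifferentiableAt ℝ f p) (hg : ContDiffAt ℝ ∞ g p) :
    curl (fun q => u q - f q • grad g q) p = curl u p - grad f p ⨯₃ grad g p := by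
  have hud : ∀ i, DifferentiableAt ℝ (fun q => u q i) p := differentiableAt_pi.1 hu
  have hgd : ∀ i, DifferentiableAt ℝ (pderiv i g) p := fun i =>
    ((hg.fderiv_right (m := ∞) (by simp)).clm_apply
      contDiffAt_const).differentiableAt (by simp)
  have hm : ∀ i k, pderiv k (fun q => u q i - f q * pderiv i g q) p =
      pderiv k (fun q => u q i) p - (f p * pderiv k (pderiv i g) p
        + pderiv i g p * pderiv k f p) := fun i k => by
    rw [pderiv_sub (hud i) (hf.fun_mul (hgd i)), pderiv_mul hf (hgd i)]
  have hc := pderiv_comm hg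
  funext k
  fin_cases k <;>
    simp only [curl, cross_apply, grad, Matrix.cons_val, hm, Pi.sub_apply, Pi.smul_apply,
      smul_eq_mul, Fin.zero_eta, Fin.mk_one, Fin.reduceFinMk]
  · linear_combination -f p * hc 1 2
  · linear_combination -f p * hc 2 0
  · linear_combination -f p * hc 0 1

end VectorCalculus

/-! ### Coordinates adapted to the symmetry. -/

section Coordinates

/-- A coordinate system with values in a cube centred at the image of `x`, whose third coordinate
vector field is `ξ`. -/
structure IsAdapted (ξ : Space → Space) (x : Space) (X : OpenPartialHomeomorph Space Space) :
    Prop where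
  mem_source : x ∈ X.source
  isCoordinateSystem : IsCoordinateSystem X
  target_eq : ∃ r > 0, X.target = Metric.ball (X x) r
  fderiv_apply : ∀ p ∈ X.source, fderiv ℝ X p (ξ p) = Pi.single 2 1

/-- By the inverse function theorem `f` is a chart near `x`. Restricting the inverse chart makes the
target a sup-norm ball, that is, a cube whose coordinate lines are connected. -/
theorem exists_isAdapted {N : Set Space} (hN : IsOpen N) {ξ f : Space → Space} {x : Space}
    (hx : x ∈ N) (hf : ContDiffOn ℝ ∞ f N) (hξ : ∀ p ∈ N, fderiv ℝ f p (ξ p) = Pi.single 2 1)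
    (hinj : ∀ v, fderiv ℝ f x v = 0 → v = 0) :
    ∃ X, IsAdapted ξ x X ∧ X.source ⊆ N ∧ ∀ p, X p = f p := by
  let A : Space ≃L[ℝ] Space := (LinearEquiv.ofInjectiveEndo (fderiv ℝ f x : Space →ₗ[ℝ] Space)
    ((injective_iff_map_eq_zero _).2 hinj)).toContinuousLinearEquiv
  have hA : fderiv ℝ f x = A := rfl
  obtain ⟨e, he, hxe, hesub, hsymm, -⟩ := exists_smooth_openPartialHomeomorph hN hf hx A hA
  have hex : e x ∈ e.target := e.map_source hxe
  obtain ⟨r, hr, hball⟩ := Metric.isOpen_iff.1 e.open_target _ hex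
  let X := (e.symm.restrOpen (Metric.ball (e x) r) Metric.isOpen_ball).symm
  have hXs : X.source ⊆ e.source := by
    intro p hp
    have h : p = e.symm (X p) := (X.left_inv hp).symm
    rw [h]
    exact e.map_target (X.map_source hp).1
  have hXt : X.target = Metric.ball (e x) r := Set.inter_eq_right.2 hball
  have hXx : x ∈ X.source := by
    have := X.map_target (hXt ▸ Metric.mem_ball_self hr : e x ∈ X.target)
    change e.symm (e x) ∈ X.source at this
    rwa [e.left_inv hxe] at this
  have hXf : ∀ p, X p = f p := he
  refine ⟨X, ⟨hXx, ⟨?_, ?_⟩, ⟨r, hr, hXt⟩, fun p hp => ?_⟩, hXs.trans hesub, hXf⟩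
  · exact (hf.mono (hXs.trans hesub)).congr fun p _ => hXf p
  · exact hsymm.mono (hXt.trans_subset hball)
  · rw [show (X : Space → Space) = f from funext hXf]
    exact hξ p (hesub (hXs hp))

variable {ξ : Space → Space} {x : Space} {X : OpenPartialHomeomorph Space Space}

theorem IsAdapted.differentiableAt (h : IsAdapted ξ x X) {p : Space} (hp : p ∈ X.source) :
    DifferentiableAt ℝ X p :=
  (h.isCoordinateSystem.1.contDiffAt (X.open_source.mem_nhds hp)).differentiableAt (by simp)

theorem IsAdapted.differentiableAt_symm (h : IsAdapted ξ x X) {p : Space} (hp : p ∈ X.source) :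
    DifferentiableAt ℝ X.symm (X p) :=
  (h.isCoordinateSystem.2.contDiffAt
    (X.open_target.mem_nhds (X.map_source hp))).differentiableAt (by simp)

theorem IsAdapted.fderiv_symm_fderiv (h : IsAdapted ξ x X) {p : Space} (hp : p ∈ X.source)
    (v : Space) : fderiv ℝ X.symm (X p) (fderiv ℝ X p v) = v := by
  have h2 := (h.differentiableAt_symm hp).hasFDerivAt.comp p (h.differentiableAt hp).hasFDerivAt
  have hev : X.symm ∘ X =ᶠ[𝓝 p] id := by
    filter_upwards [X.open_source.mem_nhds hp] with z hz using X.left_inv hz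
  exact congrArg (fun A : Space →L[ℝ] Space => A v)
    (h2.unique ((hasFDerivAt_id _).congr_of_eventuallyEq hev))

theorem IsAdapted.tangent_eq (h : IsAdapted ξ x X) {p : Space} (hp : p ∈ X.source) :
    tangent X 2 p = ξ p := by
  rw [tangent, ← h.fderiv_apply p hp, h.fderiv_symm_fderiv hp]

theorem IsAdapted.gradCoord_dotProduct (h : IsAdapted ξ x X) {p : Space} (hp : p ∈ X.source)
    (i : Fin 3) (v : Space) : gradCoord X i p ⬝ᵥ v = fderiv ℝ X p v i := by
  rw [gradCoord, ← fderiv_apply_eq_grad_dotProduct, fderiv_apply_component (h.differentiableAt hp)]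

theorem IsAdapted.fderiv_comp_symm_single (h : IsAdapted ξ x X) {g : Space → ℝ}
    (hg : DifferentiableOn ℝ g X.source) {y : Space} (hy : y ∈ X.target) :
    HasFDerivAt (g ∘ X.symm) (fderiv ℝ (g ∘ X.symm) y) y ∧
      fderiv ℝ (g ∘ X.symm) y (Pi.single 2 1) = fderiv ℝ g (X.symm y) (ξ (X.symm y)) := by
  have hp := X.map_target hy
  have h1 := h.differentiableAt_symm hp
  rw [X.right_inv hy] at h1
  have h2 := (hg.differentiableAt (X.open_source.mem_nhds hp)).hasFDerivAt.comp y h1.hasFDerivAt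
  refine ⟨h2.differentiableAt.hasFDerivAt, ?_⟩
  have h3 := h.tangent_eq hp
  rw [tangent, X.right_inv hy] at h3
  rw [h2.fderiv, ContinuousLinearMap.comp_apply, h3]

theorem mem_ball_of_mem_ball_firstTwo {y : Space} {r : ℝ} (hr : 0 < r) {s : ℝ × ℝ}
    (hs : s ∈ Metric.ball (y 0, y 1) r) : ![s.1, s.2, y 2] ∈ Metric.ball y r := by
  rw [Metric.mem_ball, dist_pi_lt_iff hr]
  rw [Metric.mem_ball, Prod.dist_eq, max_lt_iff] at hs
  intro i
  fin_cases i
  · exact hs.1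
  · exact hs.2
  · simpa using hr

theorem firstTwo_mem_ball {r : ℝ} (h : X.target = Metric.ball (X x) r) (hr : 0 < r) {p : Space}
    (hp : p ∈ X.source) : firstTwo X p ∈ Metric.ball (firstTwo X x) r := by
  have := h ▸ X.map_source hp
  rw [Metric.mem_ball, dist_pi_lt_iff hr] at this
  rw [Metric.mem_ball, Prod.dist_eq, max_lt_iff]
  exact ⟨this 0, this 1⟩

theorem IsAdapted.exists_image_firstTwo_eq_ball (h : IsAdapted ξ x X) :
    ∃ r > 0, firstTwo X '' X.source = Metric.ball (firstTwo X x) r := by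
  obtain ⟨r, hr, ht⟩ := h.target_eq
  refine ⟨r, hr, Set.Subset.antisymm ?_ fun s hs => ?_⟩
  · rintro _ ⟨p, hp, rfl⟩
    exact firstTwo_mem_ball ht hr hp
  · have hy := mem_ball_of_mem_ball_firstTwo hr hs
    rw [← ht] at hy
    exact ⟨_, X.map_target hy, by simp [firstTwo, X.right_inv hy]⟩

theorem IsAdapted.isOpen_image_firstTwo (h : IsAdapted ξ x X) :
    IsOpen (firstTwo X '' X.source) := by
  obtain ⟨r, -, hr⟩ := h.exists_image_firstTwo_eq_ball
  exact hr ▸ Metric.isOpen_ball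

/-- A smooth function invariant under `ξ` is a smooth function of the first two coordinates. -/
theorem IsAdapted.exists_onSpace_eq (h : IsAdapted ξ x X) {g : Space → ℝ}
    (hg : ContDiffOn ℝ ∞ g X.source) (hinv : ∀ p ∈ X.source, fderiv ℝ g p (ξ p) = 0) :
    ∃ F, SmoothOfFirstTwo X F ∧ ∀ p ∈ X.source, onSpace X F p = g p := by
  obtain ⟨r, hr, ht⟩ := h.target_eq
  -- The function of two variables freezes the third coordinate at its value at `x`; the cube
  -- contains the segment from this slice to any point, and `g` is constant along it.
  let ι : ℝ × ℝ → Space := fun s => ![s.1, s.2, X x 2]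
  have hι : ContDiff ℝ ∞ ι := contDiff_pi.2 fun i => by
    fin_cases i
    · exact contDiff_fst
    · exact contDiff_snd
    · exact contDiff_const
  refine ⟨fun s => g (X.symm (ι s)), ?_, fun p hp => ?_⟩
  · refine (hg.comp h.isCoordinateSystem.2 X.mapsTo_symm).comp hι.contDiffOn ?_
    rintro _ ⟨p, hp, rfl⟩
    rw [ht]
    exact mem_ball_of_mem_ball_firstTwo hr (firstTwo_mem_ball ht hr hp)
  · let c : ℝ → Space := fun t => ι (firstTwo X p) + (t - X x 2) • Pi.single 2 1
    have hc : ∀ t i, c t i = ι (firstTwo X p) i + (t - X x 2) * (Pi.single 2 1 : Space) i :=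
      fun t i => rfl
    have hc0 : ∀ t, c t 0 = X p 0 := fun t => by simp [hc, ι, firstTwo]
    have hc1 : ∀ t, c t 1 = X p 1 := fun t => by simp [hc, ι, firstTwo]
    have hc2 : ∀ t, c t 2 = t := fun t => by simp [hc, ι]
    have hXp := ht ▸ X.map_source hp
    rw [Metric.mem_ball, dist_pi_lt_iff hr] at hXp
    have hcmem : ∀ t ∈ Metric.ball (X x 2) r, c t ∈ X.target := fun t htr => by
      rw [ht, Metric.mem_ball, dist_pi_lt_iff hr]
      intro i
      fin_cases i
      · simpa [hc0] using hXp 0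
      · simpa [hc1] using hXp 1
      · simpa [hc2] using htr
    have hder : ∀ t ∈ Metric.ball (X x 2) r, HasDerivAt (fun t => (g ∘ X.symm) (c t)) 0 t :=
      fun t htr => by
        have h1 := h.fderiv_comp_symm_single (hg.differentiableOn (by simp)) (hcmem t htr)
        rw [hinv _ (X.map_target (hcmem t htr))] at h1
        have hcd : HasDerivAt c (Pi.single 2 1) t := by
          have := (((hasDerivAt_id t).sub_const (X x 2)).smul_const
            (Pi.single 2 1 : Space)).const_add (ι (firstTwo X p))
          rwa [one_smul] at this
        have := h1.1.comp_hasDerivAt t hcd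
        rwa [h1.2] at this
    have hconst := (convex_ball (X x 2) r).is_const_of_fderivWithin_eq_zero (𝕜 := ℝ)
      (f := fun t => (g ∘ X.symm) (c t))
      (fun t htr => (hder t htr).differentiableAt.differentiableWithinAt) (fun t htr => by
        rw [fderivWithin_of_isOpen Metric.isOpen_ball htr, (hder t htr).hasFDerivAt.fderiv]
        ext
        simp) (Metric.mem_ball_self hr) (hXp 2)
    have hcx : c (X x 2) = ι (firstTwo X p) := by simp [c]
    have hcp : c (X p 2) = X p := by
      funext i
      fin_cases i
      · exact hc0 _
      · exact hc1 _
      · exact hc2 _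
    simp only [Function.comp_apply, hcx, hcp, X.left_inv hp] at hconst
    exact hconst

theorem grad_onSpace {F : ℝ × ℝ → ℝ} {g : Space → ℝ}
    (hF : ∀ p ∈ X.source, onSpace X F p = g p) {p : Space} (hp : p ∈ X.source) :
    grad (onSpace X F) p = grad g p :=
  grad_congr (Filter.eventuallyEq_of_mem (X.open_source.mem_nhds hp) hF)

/-- The components along adapted coordinates of a field commuting with `ξ` are invariant
under `ξ`. -/
theorem IsAdapted.fderiv_fderiv_apply (h : IsAdapted ξ x X) {w : Space → Space}
    (hw : DifferentiableOn ℝ w X.source) (hξ : DifferentiableOn ℝ ξ X.source)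
    (hsym : IsSymmetry X.source ξ w) {p : Space} (hp : p ∈ X.source) :
    fderiv ℝ (fun q => fderiv ℝ X q (w q)) p (ξ p) = 0 := by
  have hnhds := X.open_source.mem_nhds hp
  -- The chart transports the bracket, which vanishes. As `ξ` is transported to a constant, only the
  -- derivative of the transported `w` along `ξ` remains.
  have h1 := VectorField.fderiv_apply_lieBracket (𝕜 := ℝ)
    (h.isCoordinateSystem.1.contDiffAt hnhds) (by
      rw [minSmoothness_of_isRCLikeNormedField]
      exact WithTop.coe_le_coe.2 le_top)
    (hw.differentiableAt hnhds) (hξ.differentiableAt hnhds)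
  have h2 : (fun q => fderiv ℝ X q (ξ q)) =ᶠ[𝓝 p] fun _ => Pi.single 2 1 :=
    Filter.eventuallyEq_of_mem hnhds h.fderiv_apply
  rw [hsym p hp, map_zero, h2.fderiv_eq] at h1
  simpa using h1.symm

theorem IsAdapted.contDiffOn_fderiv_apply (h : IsAdapted ξ x X) {w : Space → Space}
    (hw : ContDiffOn ℝ ∞ w X.source) :
    ContDiffOn ℝ ∞ (fun q => fderiv ℝ X q (w q)) X.source :=
  ((contDiffOn_infty_iff_fderiv_of_isOpen X.open_source).1 h.isCoordinateSystem.1).2.clm_apply hw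

/-- The contravariant components of a field commuting with `ξ` depend on the first two
coordinates only. -/
theorem IsAdapted.exists_onSpace_eq_component (h : IsAdapted ξ x X) {w : Space → Space}
    (hw : ContDiffOn ℝ ∞ w X.source) (hξ : ContDiffOn ℝ ∞ ξ X.source)
    (hsym : IsSymmetry X.source ξ w) (i : Fin 3) :
    ∃ F, SmoothOfFirstTwo X F ∧ ∀ p ∈ X.source, onSpace X F p = fderiv ℝ X p (w p) i := by
  have hs := h.contDiffOn_fderiv_apply hw
  refine h.exists_onSpace_eq (contDiffOn_component hs i) fun p hp => ?_
  have hd : DifferentiableAt ℝ (fun q => fderiv ℝ X q (w q)) p :=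
    (hs.contDiffAt (X.open_source.mem_nhds hp)).differentiableAt (by simp)
  rw [← fderiv_apply_component hd, h.fderiv_fderiv_apply (hw.differentiableOn (by simp))
    (hξ.differentiableOn (by simp)) hsym hp]
  rfl

/-- Adapted coordinates exist near each point where the smooth field `ξ` does not vanish. -/
theorem exists_isAdapted_of_ne_zero {N : Set Space} (hN : IsOpen N)
    (hξ : ContDiffOn ℝ ∞ ξ N) (hx : x ∈ N) (hξx : ξ x ≠ 0) :
    ∃ X, IsAdapted ξ x X ∧ X.source ⊆ N := by
  obtain ⟨M, ψ, hM, hxM, hMN, hψ, hψx, hψξ⟩ := exists_rectification hN hξ hx hξx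
  obtain ⟨A, hA⟩ := SeparatingDual.exists_continuousLinearEquiv_apply_eq (R := ℝ) hξx
    (show (Pi.single 2 1 : Space) ≠ 0 by simp)
  have hd : ∀ p ∈ M, HasFDerivAt (A ∘ ψ) ((A : Space →L[ℝ] Space).comp (fderiv ℝ ψ p)) p :=
    fun p hp => (A : Space →L[ℝ] Space).hasFDerivAt.comp p
      ((hψ.contDiffAt (hM.mem_nhds hp)).differentiableAt (by simp)).hasFDerivAt
  obtain ⟨X, hX, hXM, -⟩ := exists_isAdapted (f := A ∘ ψ) hM hxM (A.contDiff.comp_contDiffOn hψ)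
    (ξ := ξ) (fun p hp => by
      rw [(hd p hp).fderiv, ContinuousLinearMap.comp_apply, hψξ p hp]
      exact hA) (fun v hv => by
      rw [(hd x hxM).fderiv, hψx] at hv
      exact (map_eq_zero_iff A A.injective).1 hv)
  exact ⟨X, hX, hXM.trans hMN⟩

end Coordinates

/-! ### Triple product identities. -/

section VectorIdentities

variable {a g u v : Space}

theorem eq_cross_add_smul (h : a ⬝ᵥ v = 1) : u = -(u ⨯₃ v) ⨯₃ a + (u ⬝ᵥ a) • v := by
  simp only [dotProduct, Fin.sum_univ_three] at h
  funext i
  fin_cases i <;> simp [cross_apply, dotProduct, Fin.sum_univ_three]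
  · linear_combination (-u 0) * h
  · linear_combination (-u 1) * h
  · linear_combination (-u 2) * h

theorem cross_neg_cross (hu : a ⬝ᵥ u = 1) (hv : a ⬝ᵥ v = 0) : a ⨯₃ (-(u ⨯₃ v)) = v := by
  simp only [dotProduct, Fin.sum_univ_three] at hu hv
  funext i
  fin_cases i <;> simp [cross_apply]
  · linear_combination v 0 * hu - u 0 * hv
  · linear_combination v 1 * hu - u 1 * hv
  · linear_combination v 2 * hu - u 2 * hv

/-- The multiple of `g` drops out because `g ⨯₃ g = 0`. This recovers `w` from `∇Φ = w - Ψ∇Θ`. -/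
theorem cross_cross_of_orthogonal (h : u ⬝ᵥ g = 0) (c : ℝ) :
    g ⨯₃ ((u - c • g) ⨯₃ g) = (g ⬝ᵥ g) • u := by
  simp only [dotProduct, Fin.sum_univ_three] at h ⊢
  funext i
  fin_cases i <;> simp [cross_apply]
  · linear_combination (-g 0) * h
  · linear_combination (-g 1) * h
  · linear_combination (-g 2) * h

/-- If `b × g = v`, then the functionals `b`, `g` and any `a` with `a · v = 1` separate vectors. -/
theorem eq_zero_of_dotProduct_eq_zero {b y : Space} (hbg : b ⨯₃ g = v) (hav : a ⬝ᵥ v = 1)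
    (hb : b ⬝ᵥ y = 0) (hg : g ⬝ᵥ y = 0) (ha : a ⬝ᵥ y = 0) : y = 0 := by
  subst hbg
  simp only [dotProduct, Fin.sum_univ_three, cross_apply, Matrix.cons_val] at hav hb hg ha
  funext i
  fin_cases i <;> simp only [Pi.zero_apply, Fin.zero_eta, Fin.mk_one, Fin.reduceFinMk]
  · linear_combination (-y 0) * hav + (b 1 * g 2 - b 2 * g 1) * ha
      + (a 2 * g 1 - a 1 * g 2) * hb + (a 1 * b 2 - a 2 * b 1) * hg
  · linear_combination (-y 1) * hav + (b 2 * g 0 - b 0 * g 2) * ha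
      + (a 0 * g 2 - a 2 * g 0) * hb + (a 2 * b 0 - a 0 * b 2) * hg
  · linear_combination (-y 2) * hav + (b 0 * g 1 - b 1 * g 0) * ha
      + (a 1 * g 0 - a 0 * g 1) * hb + (a 0 * b 1 - a 1 * b 0) * hg

end VectorIdentities

/-! ### Stream function, conjugate functions and the Grad–Shafranov equation. -/

theorem exists_grad_eq_neg_cross {B : Set Space} (hB : IsOpen B) (hBc : Convex ℝ B)
    {w ξ : Space → Space} (hw : ContDiffOn ℝ ∞ w B) (hξ : ContDiffOn ℝ ∞ ξ B)
    (hw_div : ∀ p ∈ B, div w p = 0) (hξ_div : ∀ p ∈ B, div ξ p = 0) (hsym : IsSymmetry B ξ w) :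
    ∃ Θ : Space → ℝ, ContDiffOn ℝ ∞ Θ B ∧ ∀ p ∈ B, grad Θ p = -(w p ⨯₃ ξ p) :=
  exists_grad_eq_of_curl_eq_zero hB hBc (contDiffOn_cross hw hξ).neg fun p hp => by
    rw [curl_neg, curl_cross_eq_zero
      ((hw.contDiffAt (hB.mem_nhds hp)).differentiableAt (by simp))
      ((hξ.contDiffAt (hB.mem_nhds hp)).differentiableAt (by simp))
      (hw_div p hp) (hξ_div p hp) (hsym p hp), neg_zero]

/-- The representation of a field commuting with `ξ` by a stream function and its third
component. -/
theorem IsAdapted.exists_representation {ξ w : Space → Space} {x : Space}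
    {X : OpenPartialHomeomorph Space Space} (h : IsAdapted ξ x X)
    (hw : ContDiffOn ℝ ∞ w X.source) (hξ : ContDiffOn ℝ ∞ ξ X.source)
    (hsym : IsSymmetry X.source ξ w) {Θ : ℝ × ℝ → ℝ}
    (hΘ : ∀ p ∈ X.source, grad (onSpace X Θ) p = -(w p ⨯₃ ξ p)) :
    ∃ w3, SmoothOfFirstTwo X w3 ∧
      (∀ p ∈ X.source, w p ⬝ᵥ gradCoord X 2 p = onSpace X w3 p) ∧
      ∀ p ∈ X.source,
        w p = grad (onSpace X Θ) p ⨯₃ gradCoord X 2 p + onSpace X w3 p • tangent X 2 p := by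
  obtain ⟨w3, hw3, heq⟩ := h.exists_onSpace_eq_component hw hξ hsym 2
  have hc : ∀ p ∈ X.source, w p ⬝ᵥ gradCoord X 2 p = onSpace X w3 p := fun p hp => by
    rw [dotProduct_comm, h.gradCoord_dotProduct hp, heq p hp]
  refine ⟨w3, hw3, hc, fun p hp => ?_⟩
  rw [hΘ p hp, ← hc p hp, h.tangent_eq hp]
  apply eq_cross_add_smul
  rw [h.gradCoord_dotProduct hp, h.fderiv_apply p hp]
  simp

/-- Two commuting independent fields `w`, `ξ` admit a function invariant under `ξ` with unit
derivative along `w`, and a function with unit derivative along `ξ`. -/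
theorem exists_conjugate_functions {B : Set Space} (hB : IsOpen B) {w ξ : Space → Space}
    (hw : ContDiffOn ℝ ∞ w B) (hξ : ContDiffOn ℝ ∞ ξ B) (hsym : IsSymmetry B ξ w) {x : Space}
    (hx : x ∈ B) (hne : w x ⨯₃ ξ x ≠ 0) :
    ∃ (M : Set Space) (Ψ ζ : Space → ℝ), IsOpen M ∧ x ∈ M ∧ M ⊆ B ∧
      ContDiffOn ℝ ∞ Ψ M ∧ ContDiffOn ℝ ∞ ζ M ∧
      ∀ p ∈ M, fderiv ℝ Ψ p (w p) = 1 ∧ fderiv ℝ Ψ p (ξ p) = 0 ∧ fderiv ℝ ζ p (ξ p) = 1 := by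
  have hξx : ξ x ≠ 0 := fun h0 => hne (by rw [h0, map_zero])
  obtain ⟨X, hX, hXB⟩ := exists_isAdapted_of_ne_zero hB hξ hx hξx
  have hxs := hX.mem_source
  have hcomp := hX.exists_onSpace_eq_component (hw.mono hXB) (hξ.mono hXB)
    fun p hp => hsym p (hXB hp)
  obtain ⟨F₀, hF₀, hF₀eq⟩ := hcomp 0
  obtain ⟨F₁, hF₁, hF₁eq⟩ := hcomp 1
  let F : ℝ × ℝ → ℝ × ℝ := fun s => (F₀ s, F₁ s)
  have hF : ContDiffOn ℝ ∞ F (firstTwo X '' X.source) := hF₀.prodMk hF₁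
  have hFX : ∀ p ∈ X.source, F (firstTwo X p) = (fderiv ℝ X p (w p) 0, fderiv ℝ X p (w p) 1) :=
    fun p hp => Prod.ext (hF₀eq p hp) (hF₁eq p hp)
  -- If the planar part of `w` vanished at `x`, then `w x` would be a multiple of `ξ x`.
  have hFx : F (firstTwo X x) ≠ 0 := fun h0 => by
    rw [hFX x hxs, Prod.mk_eq_zero] at h0
    have h1 : fderiv ℝ X x (w x) = fderiv ℝ X x ((fderiv ℝ X x (w x) 2) • ξ x) := by
      rw [map_smul, hX.fderiv_apply x hxs]
      funext i
      fin_cases i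
      · simpa using h0.1
      · simpa using h0.2
      · simp
    have h2 := hX.fderiv_symm_fderiv hxs (w x)
    rw [h1, hX.fderiv_symm_fderiv hxs] at h2
    exact hne (by rw [← h2]; simp)
  obtain ⟨N, ψ, hN, hxN, hNs, hψ, -, hψF⟩ :=
    exists_rectification hX.isOpen_image_firstTwo hF ⟨x, hxs, rfl⟩ hFx
  -- `ψ` carries `F` to its constant value at the base point, so `ℓ ∘ ψ` has unit derivative along
  -- `F`. Pulled back by `firstTwo X` it becomes `Ψ`, unaffected by motion along `ξ`.
  obtain ⟨ℓ, hℓ⟩ := SeparatingDual.exists_eq_one (R := ℝ) hFx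
  have hXd := hX.isCoordinateSystem.1
  have h2 : ContDiffOn ℝ ∞ (firstTwo X) X.source :=
    (contDiffOn_component hXd 0).prodMk (contDiffOn_component hXd 1)
  have hM : IsOpen (X.source ∩ firstTwo X ⁻¹' N) :=
    h2.continuousOn.isOpen_inter_preimage X.open_source hN
  have hζd : ∀ p ∈ X.source, ∀ i v, fderiv ℝ (fun q => X q i) p v = fderiv ℝ X p v i :=
    fun p hp i v => (fderiv_apply_component (hX.differentiableAt hp) v i).symm
  have hfd : ∀ p ∈ X.source, ∀ v,
      fderiv ℝ (firstTwo X) p v = (fderiv ℝ X p v 0, fderiv ℝ X p v 1) := fun p hp v => by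
    have hd : ∀ i, DifferentiableAt ℝ (fun q => X q i) p :=
      differentiableAt_pi.1 (hX.differentiableAt hp)
    have : fderiv ℝ (firstTwo X) p = (fderiv ℝ (fun q => X q 0) p).prod
        (fderiv ℝ (fun q => X q 1) p) :=
      ((hd 0).hasFDerivAt.prodMk (hd 1).hasFDerivAt).fderiv
    rw [this, ContinuousLinearMap.prod_apply, hζd p hp, hζd p hp]
  have hΨd : ∀ p ∈ X.source ∩ firstTwo X ⁻¹' N, ∀ v, fderiv ℝ (fun q => ℓ (ψ (firstTwo X q))) p v
      = ℓ (fderiv ℝ ψ (firstTwo X p) (fderiv ℝ X p v 0, fderiv ℝ X p v 1)) := by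
    rintro p ⟨hp, hpN⟩ v
    have h3 : HasFDerivAt (fun q => ℓ (ψ (firstTwo X q)))
        (ℓ.comp ((fderiv ℝ ψ (firstTwo X p)).comp (fderiv ℝ (firstTwo X) p))) p :=
      ℓ.hasFDerivAt.comp p
        (((hψ.contDiffAt (hN.mem_nhds hpN)).differentiableAt (by simp)).hasFDerivAt.comp p
          ((h2.contDiffAt (X.open_source.mem_nhds hp)).differentiableAt (by simp)).hasFDerivAt)
    rw [h3.fderiv, ContinuousLinearMap.comp_apply, ContinuousLinearMap.comp_apply, hfd p hp]
  refine ⟨X.source ∩ firstTwo X ⁻¹' N, fun q => ℓ (ψ (firstTwo X q)), fun q => X q 2, hM,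
    ⟨hxs, hxN⟩, fun p hp => hXB hp.1, ℓ.contDiff.comp_contDiffOn
      (hψ.comp (h2.mono Set.inter_subset_left) fun p hp => hp.2),
    (contDiffOn_component hXd 2).mono Set.inter_subset_left, fun p hp => ⟨?_, ?_, ?_⟩⟩
  · rw [hΨd p hp, ← hFX p hp.1, hψF _ hp.2, hℓ]
  · have h0 : ((Pi.single 2 1 : Space) 0, (Pi.single 2 1 : Space) 1) = (0 : ℝ × ℝ) :=
      Prod.ext (by simp) (by simp)
    rw [hΨd p hp, hX.fderiv_apply p hp.1, h0, map_zero, map_zero]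
  · rw [hζd p hp.1, hX.fderiv_apply p hp.1]
    simp

/-- Orthogonality of `w` and `∇Θ` turns `perpGrad` into `w` and the quotient into `-Ψ`, so the
equation becomes `w · ∇Ψ = 1`. -/
theorem ggse_of_clebsch_representation {s : Set Space} (hs : IsOpen s) {w : Space → Space}
    {Θ Φ Ψ : Space → ℝ} (hΦ : ∀ q ∈ s, grad Φ q = w q - Ψ q • grad Θ q)
    (hwΘ : ∀ q ∈ s, w q ⬝ᵥ grad Θ q = 0) (hΘ : ∀ q ∈ s, grad Θ q ≠ 0) {p : Space} (hp : p ∈ s)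
    (hwΨ : grad Ψ p ⬝ᵥ w p = 1) : GGSE Θ Φ p := by
  have hpos : ∀ q ∈ s, grad Θ q ⬝ᵥ grad Θ q ≠ 0 := fun q hq h0 =>
    hΘ q hq (dotProduct_self_eq_zero.1 h0)
  have hperp : perpGrad Θ Φ p = w p := by
    rw [perpGrad, hΦ p hp, cross_cross_of_orthogonal (hwΘ p hp), smul_smul,
      inv_mul_cancel₀ (hpos p hp), one_smul]
  have hev : (fun q => (grad Θ q ⬝ᵥ grad Φ q) / (grad Θ q ⬝ᵥ grad Θ q)) =ᶠ[𝓝 p]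
      fun q => -Ψ q := by
    filter_upwards [hs.mem_nhds hp] with q hq
    rw [hΦ q hq, dotProduct_sub, dotProduct_comm, hwΘ q hq, dotProduct_smul, zero_sub,
      smul_eq_mul, neg_div, mul_div_cancel_right₀ _ (hpos q hq)]
  rw [GGSE, hperp, grad_congr hev, grad_neg, dotProduct_neg, neg_neg, dotProduct_comm, hwΨ]

end Magnetofluid

end

/-! ### The proposition. -/

open Magnetofluid in
theorem proposition2
    (Ω : Set Space) (hΩ : IsOpen Ω)
    (w ξ : Space → Space) (χ : Space → ℝ)
    (hw : ContDiffOn ℝ ∞ w Ω) (hsol : IsSolution Ω w χ)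
    (hξ : ContDiffOn ℝ ∞ ξ Ω) (hξ_div : ∀ p ∈ Ω, div ξ p = 0)
    (hξ_ne : ∀ p ∈ Ω, ξ p ≠ 0) (hξ_sym : IsSymmetry Ω ξ w)
    (x : Space) (hx : x ∈ Ω) :
    ∃ (X : OpenPartialHomeomorph Space Space) (Θ w3 : ℝ × ℝ → ℝ),
      x ∈ X.source ∧ X.source ⊆ Ω ∧ IsCoordinateSystem X ∧
      SmoothOfFirstTwo X Θ ∧ SmoothOfFirstTwo X w3 ∧
      (∀ p ∈ X.source, tangent X 2 p = ξ p) ∧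
      (∀ p ∈ X.source, w p ⬝ᵥ gradCoord X 2 p = onSpace X w3 p) ∧
      (∀ p ∈ X.source,
        w p = grad (onSpace X Θ) p ⨯₃ gradCoord X 2 p + onSpace X w3 p • tangent X 2 p) ∧
      ((∀ᶠ p in 𝓝 x, grad χ p ≠ 0 ∧ ξ p = curl w p) →
        ∃ (Ψ : ℝ × ℝ → ℝ) (Φ : Space → ℝ),
          SmoothOfFirstTwo X Ψ ∧ ContDiffOn ℝ ∞ Φ X.source ∧
          (∀ s ∈ firstTwo X '' X.source, d₁ Ψ s * d₂ Θ s - d₂ Ψ s * d₁ Θ s = 1) ∧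
          (∀ p ∈ X.source, GGSE (onSpace X Θ) Φ p) ∧
          (∀ p ∈ X.source, w p = onSpace X Ψ p • grad (onSpace X Θ) p + grad Φ p) ∧
          (∀ p ∈ X.source, χ p = -onSpace X Θ p)) := by
  -- The chart is chosen before the extra hypothesis is available, so its truth decides which chart
  -- to use; if it fails, the last clause is vacuous.
  by_cases hcase : ∀ᶠ p in 𝓝 x, grad χ p ≠ 0 ∧ ξ p = curl w p
  · obtain ⟨O, hOcase, hO, hxO⟩ := eventually_nhds_iff.1 hcase
    have hB : IsOpen (Ω ∩ O) := hΩ.inter hO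
    have hwB := hw.mono (Set.inter_subset_left (s := Ω) (t := O))
    have hξB := hξ.mono (Set.inter_subset_left (s := Ω) (t := O))
    have hχ : ∀ p ∈ Ω ∩ O, grad χ p = w p ⨯₃ ξ p := fun p hp => by
      rw [(hOcase p hp.2).2, hsol.force_balance p hp.1]
    have hχd : ∀ p ∈ Ω, DifferentiableAt ℝ χ p := fun p hp =>
      (hsol.contDiffOn_pressure.contDiffAt (hΩ.mem_nhds hp)).differentiableAt one_ne_zero
    -- `χ` is only assumed `C¹`, but its gradient `w ⨯₃ ξ` is smooth.
    have hχs : ContDiffOn ℝ ∞ χ (Ω ∩ O) :=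
      contDiffOn_of_hasFDerivAt_dotProduct hB (contDiffOn_cross hwB hξB) fun p hp =>
        hχ p hp ▸ hasFDerivAt_dotProduct_grad (hχd p hp.1)
    obtain ⟨M, Ψ, ζ, hM, hxM, hMB, hΨ, hζ, hder⟩ := exists_conjugate_functions hB hwB hξB
      (fun p hp => hξ_sym p hp.1) ⟨hx, hxO⟩ (hχ x ⟨hx, hxO⟩ ▸ (hOcase x hxO).1)
    obtain ⟨ε, hε, hεM⟩ := Metric.isOpen_iff.1 hM x hxM
    set D := Metric.ball x ε
    have hD : IsOpen D := Metric.isOpen_ball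
    have hDB : D ⊆ Ω ∩ O := hεM.trans hMB
    let T : Space → ℝ := fun q => -χ q
    have hT : ContDiffOn ℝ ∞ T D := (hχs.mono hDB).neg
    have hTg : ∀ p ∈ D, grad T p = -(w p ⨯₃ ξ p) := fun p hp => by
      rw [grad_neg, hχ p (hDB hp)]
    have hΨw : ∀ p ∈ D, grad Ψ p ⬝ᵥ w p = 1 := fun p hp => by
      rw [← fderiv_apply_eq_grad_dotProduct, (hder p (hεM hp)).1]
    have hΨξ : ∀ p ∈ D, grad Ψ p ⬝ᵥ ξ p = 0 := fun p hp => by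
      rw [← fderiv_apply_eq_grad_dotProduct, (hder p (hεM hp)).2.1]
    have hcross : ∀ p ∈ D, grad Ψ p ⨯₃ grad T p = ξ p := fun p hp => by
      rw [hTg p hp, cross_neg_cross (hΨw p hp) (hΨξ p hp)]
    have hwT : ∀ p ∈ D, w p ⬝ᵥ grad T p = 0 := fun p hp => by
      rw [hTg p hp, dotProduct_neg, dot_self_cross, neg_zero]
    have hξT : ∀ p ∈ D, grad T p ⬝ᵥ ξ p = 0 := fun p hp => by
      rw [hTg p hp, dotProduct_comm, dotProduct_neg, dot_cross_self, neg_zero]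
    have hT0 : ∀ p ∈ D, grad T p ≠ 0 := fun p hp h0 =>
      hξ_ne p (hDB hp).1 (by rw [← hcross p hp, h0, map_zero])
    have hΨD := hΨ.mono hεM
    obtain ⟨Φ, hΦ, hΦg⟩ := exists_grad_eq_of_curl_eq_zero (u := fun q => w q - Ψ q • grad T q)
      hD (convex_ball x ε) ((hwB.mono hDB).sub (hΨD.smul (ContDiffOn.grad hD hT))) fun p hp => by
        have hnhds := hD.mem_nhds hp
        rw [curl_sub_smul_grad
          (((hwB.mono hDB).contDiffAt hnhds).differentiableAt (by simp))
          ((hΨD.contDiffAt hnhds).differentiableAt (by simp)) (hT.contDiffAt hnhds),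
          hcross p hp, (hOcase p (hDB hp).2).2, sub_self]
    -- These are independent at `x` because `∇Ψ ⨯₃ ∇T = ξ` and `∇ζ · ξ = 1`. In this chart `Ψ` and
    -- `Θ` are the coordinate projections.
    let f : Space → Space := fun q => ![Ψ q, T q, ζ q]
    have hf : ContDiffOn ℝ ∞ f D := contDiffOn_pi.2 fun i => by
      fin_cases i
      · exact hΨD
      · exact hT
      · exact hζ.mono hεM
    have hfd : ∀ p ∈ D, ∀ v, fderiv ℝ f p v = ![grad Ψ p ⬝ᵥ v, grad T p ⬝ᵥ v, grad ζ p ⬝ᵥ v] :=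
      fun p hp v => by
        have hd : DifferentiableAt ℝ f p :=
          (hf.contDiffAt (hD.mem_nhds hp)).differentiableAt (by simp)
        funext i
        rw [fderiv_apply_component hd, fderiv_apply_eq_grad_dotProduct]
        fin_cases i <;> rfl
    have hζξ : ∀ p ∈ D, grad ζ p ⬝ᵥ ξ p = 1 := fun p hp => by
      rw [← fderiv_apply_eq_grad_dotProduct, (hder p (hεM hp)).2.2]
    have hxD : x ∈ D := Metric.mem_ball_self hε
    obtain ⟨X, hX, hXD, hXf⟩ := exists_isAdapted hD hxD hf (ξ := ξ) (fun p hp => by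
      rw [hfd p hp, hΨξ p hp, hξT p hp, hζξ p hp]
      funext i
      fin_cases i <;> rfl) (fun v hv => by
      rw [hfd x hxD] at hv
      exact eq_zero_of_dotProduct_eq_zero (hcross x hxD) (hζξ x hxD) (congrFun hv 0)
        (congrFun hv 1) (congrFun hv 2))
    have hΘX : ∀ p ∈ X.source, onSpace X Prod.snd p = T p := fun p _ => congrFun (hXf p) 1
    have hΨX : ∀ p ∈ X.source, onSpace X Prod.fst p = Ψ p := fun p _ => congrFun (hXf p) 0
    have hΘg : ∀ p ∈ X.source, grad (onSpace X Prod.snd) p = grad T p := fun p hp =>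
      grad_onSpace hΘX hp
    have hXΩ : X.source ⊆ Ω := fun p hp => (hDB (hXD hp)).1
    obtain ⟨w3, hw3, hw3c, hrep⟩ := hX.exists_representation (hw.mono hXΩ) (hξ.mono hXΩ)
      (fun p hp => hξ_sym p (hXΩ hp)) (Θ := Prod.snd) fun p hp => by
        rw [hΘg p hp, hTg p (hXD hp)]
    refine ⟨X, Prod.snd, w3, hX.mem_source, hXΩ, hX.isCoordinateSystem, contDiff_snd.contDiffOn,
      hw3, fun p hp => hX.tangent_eq hp, hw3c, hrep, fun _ => ⟨Prod.fst, Φ,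
        contDiff_fst.contDiffOn, hΦ.mono hXD, fun s _ => by simp [d₁, d₂, fderiv_fst, fderiv_snd],
        fun p hp => ?_, fun p hp => ?_, fun p hp => ?_⟩⟩
    · refine ggse_of_clebsch_representation X.open_source (w := w) (Ψ := Ψ) (fun q hq => ?_)
        (fun q hq => ?_) (fun q hq => ?_) hp (hΨw p (hXD hp))
      · rw [hΦg q (hXD hq), hΘg q hq]
      · rw [hΘg q hq, hwT q (hXD hq)]
      · rw [hΘg q hq]
        exact hT0 q (hXD hq)
    · rw [hΨX p hp, hΘg p hp, hΦg p (hXD hp), add_sub_cancel]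
    · rw [hΘX p hp, neg_neg]
  · obtain ⟨ε, hε, hεΩ⟩ := Metric.isOpen_iff.1 hΩ x hx
    obtain ⟨T, hT, hTg⟩ := exists_grad_eq_neg_cross Metric.isOpen_ball (convex_ball x ε)
      (hw.mono hεΩ) (hξ.mono hεΩ) (fun p hp => hsol.div_eq_zero p (hεΩ hp))
      (fun p hp => hξ_div p (hεΩ hp)) fun p hp => hξ_sym p (hεΩ hp)
    obtain ⟨X, hX, hXD⟩ := exists_isAdapted_of_ne_zero Metric.isOpen_ball (hξ.mono hεΩ)
      (Metric.mem_ball_self hε) (hξ_ne x hx)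
    have hXΩ := hXD.trans hεΩ
    -- `T` is invariant under `ξ` because `w ⨯₃ ξ` is orthogonal to `ξ`.
    obtain ⟨Θ, hΘ, hΘX⟩ := hX.exists_onSpace_eq (hT.mono hXD) fun p hp => by
      rw [fderiv_apply_eq_grad_dotProduct, hTg p (hXD hp), dotProduct_comm, dotProduct_neg,
        dot_cross_self, neg_zero]
    obtain ⟨w3, hw3, hw3c, hrep⟩ := hX.exists_representation (hw.mono hXΩ) (hξ.mono hXΩ)
      (fun p hp => hξ_sym p (hXΩ hp)) (Θ := Θ) fun p hp => by
        rw [grad_onSpace hΘX hp, hTg p (hXD hp)]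
    exact ⟨X, Θ, w3, hX.mem_source, hXΩ, hX.isCoordinateSystem, hΘ, hw3,
      fun p hp => hX.tangent_eq hp, hw3c, hrep, fun h => absurd h hcase⟩
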